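/- Call a set or category *large* if it lies in a fixed Grothendieck universe, and let $\mathbf{SET}$ be the category of large sets. Let $\mathcal M=(\mathcal M,I,\otimes)$ be a metatheory, i.e. a large monoidal category. Let $\widehat{\mathcal M}=([\mathcal M^{\mathrm{op}},\mathbf{SET}],\widehat I,\widehat\otimes)$ be its presheaf category with the Day convolution monoidal structure: $\widehat I=\mathcal M(-,I)$ and $$(Q\mathbin{\widehat\otimes}P)(Z)=\int^{X,Y\in\mathcal M}\mathcal M(Z,Y\otimes X)\times Q(Y)\times P(X).$$ **Enrichments.** For a monoidal category $\mathcal V=(\mathcal V,I,\otimes)$, the 2-category $\mathrm{Enrich}(\mathcal V)$ is as follows. An object is a large category $\mathcal C$ with a functor $\langle-,-\rangle\colon\mathcal C^{\mathrm{op}}\times\mathcal C\to\mathcal V$, a family $j_C\colon I\to\langle C,C\rangle$ extranatural in $C$, and a family $M_{A,B,C}\colon\langle B,C\rangle\otimes\langle A,B\rangle\to\langle A,C\rangle$ natural in $A,C$ and extranatural in $B$, such that, up to the structural isomorphisms of $\mathcal V$, $M_{A,B,B}\circ(j_B\otimes\langle A,B\rangle)$ and $M_{A,A,B}\circ(\langle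 A,B\rangle\otimes j_A)$ are identities and $M_{A,B,D}\circ(M_{B,C,D}\otimes\langle A,B\rangle)=M_{A,C,D}\circ(\langle C,D\rangle\otimes M_{A,B,C})$. A 1-cell is a pair $(G,g)$ of a functor $G\colon\mathcal C\to\mathcal C'$ and a natural family $g_{A,B}\colon\langle A,B\rangle\to\langle GA,GB\rangle'$ with $g_{C,C}\circ j_C=j'_{GC}$ and $g_{A,C}\circ M_{A,B,C}=M'_{GA,GB,GC}\circ(g_{B,C}\otimes g_{A,B})$. A 2-cell $(G,g)\Rightarrow(G',g')$ is a natural transformation $\theta\colon G\Rightarrow G'$ with $\langle GA,\theta_B\rangle'\circ g_{A,B}=\langle\theta_A,G'B\rangle'\circ g'_{A,B}$. Identities, compositions and whiskerings are the evident ones. **Metamodels.** The 2-category $\mathrm{MtMod}(\mathcal M)$ is as follows. An object (a *metamodel of* $\mathcal M$) is a large category $\mathcal C$ with a functor $\Phi\colon\mathcal M^{\mathrm{op}}\times\mathcal C^{\mathrm{op}}\times\mathcal C\to\mathbf{SET}$, written $(X,A,B)\mapsto\Phi_X(A,B)$, a family of elements $(\overline\phi_\cdot)_C\in\Phi_I(C,C)$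 extranatural in $C$, and a family of functions $(\overline\phi_{X,Y})_{A,B,C}\colon\Phi_Y(B,C)\times\Phi_X(A,B)\to\Phi_{Y\otimes X}(A,C)$ natural in $X,Y,A,C$ and extranatural in $B$, such that, modulo the isomorphisms obtained by applying $\Phi$ to the structural isomorphisms of $\mathcal M$, $\overline\phi$ is associative and $\overline\phi_\cdot$ is a left and right unit for it. A 1-cell is a pair $(G,g)$ of a functor $G\colon\mathcal C\to\mathcal C'$ and a natural family $g_{X,A,B}\colon\Phi_X(A,B)\to\Phi'_X(GA,GB)$ which preserves $\overline\phi_\cdot$ and $\overline\phi$. A 2-cell $(G,g)\Rightarrow(G',g')$ is a natural transformation $\theta\colon G\Rightarrow G'$ with $\Phi'_X(GA,\theta_B)\circ g_{X,A,B}=\Phi'_X(\theta_A,G'B)\circ g'_{X,A,B}$. Identities, compositions and whiskerings are the evident ones. **Proposition.** The 2-categories $\mathrm{MtMod}(\mathcal M)$ and $\mathrm{Enrich}(\widehat{\mathcal M})$ are canonically isomorphic. More precisely, the 2-functor $\mathrm{Enrich}(\widehat{\mathcal M})\to\mathrm{MtMod}(\mathcal M)$ which * sends $(\mathcal C,\langle-,-\rangle,j,M)$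 to the metamodel on $\mathcal C$ with $\Phi_X(A,B)=\langle A,B\rangle(X)$, with $(\overline\phi_\cdot)_C\in\langle C,C\rangle(I)$ the element that corresponds to $j_C\colon\mathcal M(-,I)\to\langle C,C\rangle$ under the Yoneda lemma, and with $(\overline\phi_{X,Y})_{A,B,C}$ the composite of the canonical map $\langle B,C\rangle(Y)\times\langle A,B\rangle(X)\to(\langle B,C\rangle\mathbin{\widehat\otimes}\langle A,B\rangle)(Y\otimes X)$ with the component of $M_{A,B,C}$ at $Y\otimes X$; * sends a 1-cell $(G,(g_{A,B})_{A,B})$ to $(G,((g_{A,B})_X)_{X,A,B})$, and a 2-cell $\theta$ to $\theta$ is an isomorphism of 2-categories: it is bijective on objects and induces isomorphisms between hom-categories. -/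

import Mathlib

open CategoryTheory MonoidalCategory Opposite Bicategory
open scoped DayFunctor CategoryTheory.Prod

universe w v u

/-! ## Enrichments over a monoidal category and their 2-category -/

section Enrichment

/-- The value `⟨A, B⟩` of a functor `H : Cᵒᵖ × C ⥤ V`. -/
abbrev homAt {C : Type w} [SmallCategory C] {V : Type u} [Category.{v} V]
    (H : Cᵒᵖ × C ⥤ V) (A B : C) : V :=
  H.obj (op A, B)

/-- The action `⟨a, b⟩ : ⟨A, B⟩ ⟶ ⟨A', B'⟩` of a functor `H : Cᵒᵖ × C ⥤ V`. -/
abbrev homMap {C : Type w} [SmallCategory C] {V : Type u} [Category.{v} V]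
    (H : Cᵒᵖ × C ⥤ V) {A A' B B' : C} (a : A' ⟶ A) (b : B ⟶ B') :
    homAt H A B ⟶ homAt H A' B' :=
  H.map (a.op ×ₘ b)

theorem homMap_id {C : Type w} [SmallCategory C] {V : Type u} [Category.{v} V]
    (H : Cᵒᵖ × C ⥤ V) (A B : C) : homMap H (𝟙 A) (𝟙 B) = 𝟙 (homAt H A B) :=
  H.map_id (op A, B)

theorem homMap_comp {C : Type w} [SmallCategory C] {V : Type u} [Category.{v} V]
    (H : Cᵒᵖ × C ⥤ V) {A A' A'' B B' B'' : C} (a : A' ⟶ A) (a' : A'' ⟶ A')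
    (b : B ⟶ B') (b' : B' ⟶ B'') :
    homMap H a b ≫ homMap H a' b' = homMap H (a' ≫ a) (b ≫ b') :=
  (H.map_comp (a.op ×ₘ b : (op A, B) ⟶ (op A', B'))
    (a'.op ×ₘ b' : (op A', B') ⟶ (op A'', B''))).symm

/-- An enrichment over a monoidal category `V`, with underlying category in the universe `w`.
Naturality of a family in a variable which occurs both covariantly and contravariantly on one
side (the variable of `j`, the middle variable of `M`) means extranaturality. -/
structure Enrichment (V : Type u) [Category.{v} V] [MonoidalCategory V] where
  /-- the underlying category -/
  C : Type w
  [cat : SmallCategory C]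
  /-- the functor `⟨-,-⟩` -/
  H : Cᵒᵖ × C ⥤ V
  j (A : C) : 𝟙_ V ⟶ homAt H A A
  M (A B D : C) : homAt H B D ⊗ homAt H A B ⟶ homAt H A D
  j_natural {A B : C} (f : A ⟶ B) :
    j A ≫ homMap H (𝟙 A) f = j B ≫ homMap H f (𝟙 B)
  M_natural {A A' D D' : C} (B : C) (a : A' ⟶ A) (d : D ⟶ D') :
    (homMap H (𝟙 B) d ⊗ₘ homMap H a (𝟙 B)) ≫ M A' B D' = M A B D ≫ homMap H a d
  M_extranatural {B B' : C} (A D : C) (b : B ⟶ B') :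
    (homMap H b (𝟙 D) ▷ homAt H A B) ≫ M A B D =
      (homAt H B' D ◁ homMap H (𝟙 A) b) ≫ M A B' D
  left_unit (A B : C) : (j B ▷ homAt H A B) ≫ M A B B = (λ_ (homAt H A B)).hom
  right_unit (A B : C) : (homAt H A B ◁ j A) ≫ M A A B = (ρ_ (homAt H A B)).hom
  assoc (A B C' D : C) :
    (M B C' D ▷ homAt H A B) ≫ M A B D =
      (α_ (homAt H C' D) (homAt H B C') (homAt H A B)).hom ≫
        (homAt H C' D ◁ M A B C') ≫ M A C' D

attribute [instance] Enrichment.cat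

namespace Enrichment

variable {V : Type u} [Category.{v} V] [MonoidalCategory V]

/-- A 1-cell `(G, g)` of enrichments. -/
@[ext]
structure Hom (E E' : Enrichment.{w} V) where
  G : E.C ⥤ E'.C
  g (A B : E.C) : homAt E.H A B ⟶ homAt E'.H (G.obj A) (G.obj B)
  g_natural {A A' B B' : E.C} (a : A' ⟶ A) (b : B ⟶ B') :
    homMap E.H a b ≫ g A' B' = g A B ≫ homMap E'.H (G.map a) (G.map b)
  unit (A : E.C) : E.j A ≫ g A A = E'.j (G.obj A)
  comp (A B D : E.C) :
    E.M A B D ≫ g A D = (g B D ⊗ₘ g A B) ≫ E'.M (G.obj A) (G.obj B) (G.obj D)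

/-- A 2-cell of enrichments. -/
@[ext]
structure Hom₂ {E E' : Enrichment.{w} V} (F F' : Hom E E') where
  θ : F.G ⟶ F'.G
  comm (A B : E.C) :
    F.g A B ≫ homMap E'.H (𝟙 (F.G.obj A)) (θ.app B) =
      F'.g A B ≫ homMap E'.H (θ.app A) (𝟙 (F'.G.obj B))

instance (E E' : Enrichment.{w} V) : Category (Hom E E') where
  Hom F F' := Hom₂ F F'
  id F := { θ := 𝟙 F.G, comm := fun A B => by simp }
  comp {F F' F''} α β :=
    { θ := α.θ ≫ β.θ
      comm := fun A B => by
        have h1 : homMap E'.H (𝟙 (F.G.obj A)) ((α.θ ≫ β.θ).app B) =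
            homMap E'.H (𝟙 (F.G.obj A)) (α.θ.app B) ≫
              homMap E'.H (𝟙 (F.G.obj A)) (β.θ.app B) := by
          rw [homMap_comp]; simp
        have h2 : homMap E'.H ((α.θ ≫ β.θ).app A) (𝟙 (F''.G.obj B)) =
            homMap E'.H (β.θ.app A) (𝟙 (F''.G.obj B)) ≫
              homMap E'.H (α.θ.app A) (𝟙 (F''.G.obj B)) := by
          rw [homMap_comp]; simp
        have h3 : homMap E'.H (α.θ.app A) (𝟙 (F'.G.obj B)) ≫
              homMap E'.H (𝟙 (F.G.obj A)) (β.θ.app B) =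
            homMap E'.H (𝟙 (F'.G.obj A)) (β.θ.app B) ≫
              homMap E'.H (α.θ.app A) (𝟙 (F''.G.obj B)) := by
          rw [homMap_comp, homMap_comp]; simp
        rw [h1, h2, ← Category.assoc, α.comm A B, Category.assoc, h3, ← Category.assoc,
          β.comm A B, Category.assoc] }

theorem id_θ_app {E E' : Enrichment.{w} V} (F : Hom E E') (A : E.C) :
    (Hom₂.θ (𝟙 F)).app A = 𝟙 (F.G.obj A) := rfl

theorem comp_θ_app {E E' : Enrichment.{w} V} {F F' F'' : Hom E E'} (α : F ⟶ F')
    (β : F' ⟶ F'') (A : E.C) :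
    (Hom₂.θ (α ≫ β)).app A = (Hom₂.θ α).app A ≫ (Hom₂.θ β).app A := rfl

theorem hom₂_ext {E E' : Enrichment.{w} V} {F F' : Hom E E'} {α β : F ⟶ F'}
    (h : ∀ A, (Hom₂.θ α).app A = (Hom₂.θ β).app A) : α = β :=
  Hom₂.ext (NatTrans.ext (funext h))

theorem eqToHom_θ_app {E E' : Enrichment.{w} V} {F F' : Hom E E'} (h : F = F') (A : E.C) :
    (Hom₂.θ (eqToHom h)).app A = eqToHom (by rw [h]) := by
  subst h; rfl

/-- The identity 1-cell. -/
def Hom.id (E : Enrichment.{w} V) : Hom E E where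
  G := 𝟭 E.C
  g A B := 𝟙 _
  g_natural a b := by simp
  unit A := by simp
  comp A B D := by simp

/-- Composition of 1-cells. -/
def Hom.compHom {E E' E'' : Enrichment.{w} V} (F : Hom E E') (K : Hom E' E'') : Hom E E'' where
  G := F.G ⋙ K.G
  g A B := F.g A B ≫ K.g (F.G.obj A) (F.G.obj B)
  g_natural a b := by
    rw [← Category.assoc, F.g_natural, Category.assoc, K.g_natural, Category.assoc]; rfl
  unit A := by rw [← Category.assoc, F.unit, K.unit]; rfl
  comp A B D := by
    rw [← Category.assoc, F.comp, Category.assoc, K.comp, ← Category.assoc,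
      tensorHom_comp_tensorHom]; rfl

/-- Whiskering of a 2-cell by a 1-cell on the left. -/
def Hom.whiskerL {E E' E'' : Enrichment.{w} V} (F : Hom E E') {K K' : Hom E' E''}
    (β : Hom₂ K K') : Hom₂ (F.compHom K) (F.compHom K') where
  θ := Functor.whiskerLeft F.G β.θ
  comm A B := by
    have := β.comm (F.G.obj A) (F.G.obj B)
    exact (Category.assoc _ _ _).trans
      ((congrArg (fun t => F.g A B ≫ t) this).trans (Category.assoc _ _ _).symm)

/-- Whiskering of a 2-cell by a 1-cell on the right. -/
def Hom.whiskerR {E E' E'' : Enrichment.{w} V} {F F' : Hom E E'} (α : Hom₂ F F')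
    (K : Hom E' E'') : Hom₂ (F.compHom K) (F'.compHom K) where
  θ := Functor.whiskerRight α.θ K.G
  comm A B := by
    have h := α.comm A B
    have h1 := K.g_natural (𝟙 (F.G.obj A)) (α.θ.app B)
    have h2 := K.g_natural (α.θ.app A) (𝟙 (F'.G.obj B))
    rw [CategoryTheory.Functor.map_id] at h1 h2
    refine (Category.assoc _ _ _).trans (Eq.trans ?_ (Category.assoc _ _ _).symm)
    refine (congrArg (fun t => F.g A B ≫ t) h1.symm).trans ?_
    refine Eq.trans ?_ (congrArg (fun t => F'.g A B ≫ t) h2)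
    rw [← Category.assoc, ← Category.assoc, h]

theorem Hom.id_compHom {E E' : Enrichment.{w} V} (F : Hom E E') :
    (Hom.id E).compHom F = F :=
  Hom.ext rfl (heq_of_eq (funext fun _ => funext fun _ => Category.id_comp _))

theorem Hom.compHom_id {E E' : Enrichment.{w} V} (F : Hom E E') :
    F.compHom (Hom.id E') = F :=
  Hom.ext rfl (heq_of_eq (funext fun _ => funext fun _ => Category.comp_id _))

theorem Hom.compHom_assoc {E₁ E₂ E₃ E₄ : Enrichment.{w} V} (F : Hom E₁ E₂) (K : Hom E₂ E₃)
    (L : Hom E₃ E₄) : (F.compHom K).compHom L = F.compHom (K.compHom L) :=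
  Hom.ext rfl (heq_of_eq (funext fun _ => funext fun _ => Category.assoc _ _ _))

theorem whiskerL_app {E E' E'' : Enrichment.{w} V} (F : Hom E E') {K K' : Hom E' E''}
    (β : K ⟶ K') (A : E.C) :
    (Hom₂.θ (F := F.compHom K) (F' := F.compHom K') (Hom.whiskerL F β)).app A =
      (Hom₂.θ β).app (F.G.obj A) := rfl

theorem whiskerR_app {E E' E'' : Enrichment.{w} V} {F F' : Hom E E'} (α : F ⟶ F')
    (K : Hom E' E'') (A : E.C) :
    (Hom₂.θ (F := F.compHom K) (F' := F'.compHom K) (Hom.whiskerR α K)).app A =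
      K.G.map ((Hom₂.θ α).app A) := rfl

theorem id_compHom_app {E E' : Enrichment.{w} V} (F : Hom E E') (A : E.C) :
    (Hom₂.θ (eqToHom F.id_compHom)).app A = 𝟙 (F.G.obj A) := eqToHom_θ_app _ _

theorem id_compHom_app' {E E' : Enrichment.{w} V} (F : Hom E E') (A : E.C) :
    (Hom₂.θ (eqToHom F.id_compHom.symm)).app A = 𝟙 (F.G.obj A) := eqToHom_θ_app _ _

theorem compHom_id_app {E E' : Enrichment.{w} V} (F : Hom E E') (A : E.C) :
    (Hom₂.θ (eqToHom F.compHom_id)).app A = 𝟙 (F.G.obj A) := eqToHom_θ_app _ _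

theorem compHom_id_app' {E E' : Enrichment.{w} V} (F : Hom E E') (A : E.C) :
    (Hom₂.θ (eqToHom F.compHom_id.symm)).app A = 𝟙 (F.G.obj A) := eqToHom_θ_app _ _

theorem compHom_assoc_app {E₁ E₂ E₃ E₄ : Enrichment.{w} V} (F : Hom E₁ E₂) (K : Hom E₂ E₃)
    (L : Hom E₃ E₄) (A : E₁.C) :
    (Hom₂.θ (eqToHom (Hom.compHom_assoc F K L))).app A = 𝟙 (L.G.obj (K.G.obj (F.G.obj A))) :=
  eqToHom_θ_app _ _

theorem compHom_assoc_app' {E₁ E₂ E₃ E₄ : Enrichment.{w} V} (F : Hom E₁ E₂) (K : Hom E₂ E₃)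
    (L : Hom E₃ E₄) (A : E₁.C) :
    (Hom₂.θ (eqToHom (Hom.compHom_assoc F K L).symm)).app A =
      𝟙 (L.G.obj (K.G.obj (F.G.obj A))) :=
  eqToHom_θ_app _ _

set_option linter.unusedSimpArgs false in
/-- Enrichments over `V`, 1-cells and 2-cells form a bicategory, which is a 2-category by the
instance below: its associators and unitors are equalities. -/
instance : Bicategory (Enrichment.{w} V) where
  Hom E E' := Hom E E'
  id E := Hom.id E
  comp F K := Hom.compHom F K
  whiskerLeft F _ _ β := Hom.whiskerL F β
  whiskerRight α K := Hom.whiskerR α K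
  associator F K L := eqToIso (Hom.compHom_assoc F K L)
  leftUnitor F := eqToIso (Hom.id_compHom F)
  rightUnitor F := eqToIso (Hom.compHom_id F)
  whiskerLeft_id _ _ := hom₂_ext fun _ => rfl
  whiskerLeft_comp _ _ _ _ _ _ := hom₂_ext fun _ => rfl
  id_whiskerLeft _ := by
    apply hom₂_ext; intro
    simp only [comp_θ_app, whiskerL_app, whiskerR_app, eqToIso.hom, eqToIso.inv, id_compHom_app,
      id_compHom_app', compHom_id_app, compHom_id_app', compHom_assoc_app, compHom_assoc_app']
    exact ((Category.id_comp _).trans (Category.comp_id _)).symm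
  comp_whiskerLeft _ _ _ _ _ := by
    apply hom₂_ext; intro
    simp only [comp_θ_app, whiskerL_app, whiskerR_app, eqToIso.hom, eqToIso.inv, id_compHom_app,
      id_compHom_app', compHom_id_app, compHom_id_app', compHom_assoc_app, compHom_assoc_app']
    exact ((Category.id_comp _).trans (Category.comp_id _)).symm
  id_whiskerRight _ K := hom₂_ext fun _ => K.G.map_id _
  comp_whiskerRight _ _ K := hom₂_ext fun _ => K.G.map_comp _ _
  whiskerRight_id _ := by
    apply hom₂_ext; intro
    simp only [comp_θ_app, whiskerL_app, whiskerR_app, eqToIso.hom, eqToIso.inv, id_compHom_app,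
      id_compHom_app', compHom_id_app, compHom_id_app', compHom_assoc_app, compHom_assoc_app']
    exact ((Category.id_comp _).trans (Category.comp_id _)).symm
  whiskerRight_comp _ _ _ := by
    apply hom₂_ext; intro
    simp only [comp_θ_app, whiskerL_app, whiskerR_app, eqToIso.hom, eqToIso.inv, id_compHom_app,
      id_compHom_app', compHom_id_app, compHom_id_app', compHom_assoc_app, compHom_assoc_app']
    exact ((Category.id_comp _).trans (Category.comp_id _)).symm
  whisker_assoc _ _ _ _ _ := by
    apply hom₂_ext; intro
    simp only [comp_θ_app, whiskerL_app, whiskerR_app, eqToIso.hom, eqToIso.inv, id_compHom_app,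
      id_compHom_app', compHom_id_app, compHom_id_app', compHom_assoc_app, compHom_assoc_app']
    exact ((Category.id_comp _).trans (Category.comp_id _)).symm
  whisker_exchange _ β := hom₂_ext fun _ => ((Hom₂.θ β).naturality _).symm
  pentagon _ _ _ L := by
    apply hom₂_ext; intro
    simp only [comp_θ_app, whiskerL_app, whiskerR_app, eqToIso.hom, eqToIso.inv, id_compHom_app,
      id_compHom_app', compHom_id_app, compHom_id_app', compHom_assoc_app, compHom_assoc_app']
    refine (congrArg (fun t => t ≫ _) (L.G.map_id _)).trans ?_
    exact Category.id_comp _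
  triangle _ K := by
    apply hom₂_ext; intro
    simp only [comp_θ_app, whiskerL_app, whiskerR_app, eqToIso.hom, eqToIso.inv, id_compHom_app,
      id_compHom_app', compHom_id_app, compHom_id_app', compHom_assoc_app, compHom_assoc_app']
    exact (Category.id_comp _).trans (K.G.map_id _).symm

instance : Bicategory.Strict (Enrichment.{w} V) where
  id_comp := Hom.id_compHom
  comp_id := Hom.compHom_id
  assoc := Hom.compHom_assoc

end Enrichment

end Enrichment

/-! ## Metamodels of a monoidal category and their 2-category -/

section Metamodel

/-- The set `Φ_X(A, B)`. -/
abbrev phiAt {M C : Type u} [SmallCategory M] [SmallCategory C]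
    (Φ : Mᵒᵖ × Cᵒᵖ × C ⥤ Type u) (X : M) (A B : C) : Type u :=
  Φ.obj (op X, op A, B)

/-- The function `Φ_x(a, b) : Φ_X(A, B) → Φ_X'(A', B')`. -/
def phiMap {M C : Type u} [SmallCategory M] [SmallCategory C]
    (Φ : Mᵒᵖ × Cᵒᵖ × C ⥤ Type u) {X X' : M} {A A' B B' : C} (x : X' ⟶ X) (a : A' ⟶ A)
    (b : B ⟶ B') (p : phiAt Φ X A B) : phiAt Φ X' A' B' :=
  Φ.map (x.op ×ₘ a.op ×ₘ b : (op X, op A, B) ⟶ (op X', op A', B')) p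

theorem phiMap_id {M C : Type u} [SmallCategory M] [SmallCategory C]
    (Φ : Mᵒᵖ × Cᵒᵖ × C ⥤ Type u) {X : M} {A B : C} (p : phiAt Φ X A B) :
    phiMap Φ (𝟙 X) (𝟙 A) (𝟙 B) p = p :=
  ConcreteCategory.congr_hom (Φ.map_id (op X, op A, B)) p

theorem phiMap_comp {M C : Type u} [SmallCategory M] [SmallCategory C]
    (Φ : Mᵒᵖ × Cᵒᵖ × C ⥤ Type u) {X X' X'' : M} {A A' A'' B B' B'' : C} (x : X' ⟶ X)
    (x' : X'' ⟶ X') (a : A' ⟶ A) (a' : A'' ⟶ A') (b : B ⟶ B') (b' : B' ⟶ B'')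
    (p : phiAt Φ X A B) :
    phiMap Φ x' a' b' (phiMap Φ x a b p) = phiMap Φ (x' ≫ x) (a' ≫ a) (b ≫ b') p :=
  (ConcreteCategory.congr_hom (Φ.map_comp
    (x.op ×ₘ a.op ×ₘ b : (op X, op A, B) ⟶ (op X', op A', B'))
    (x'.op ×ₘ a'.op ×ₘ b' : (op X', op A', B') ⟶ (op X'', op A'', B''))) p).symm

/-- A metamodel of a monoidal category `M`. The element `φ₀ A` of `Φ_I(A, A)` is the function
`1 → Φ_I(A, A)`, and `φ q p` is the image of `(q, p)` under
`Φ_Y(B, D) × Φ_X(A, B) → Φ_{Y ⊗ X}(A, D)`. -/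
structure Metamodel (M : Type u) [SmallCategory M] [MonoidalCategory M] where
  /-- the underlying category -/
  C : Type u
  [cat : SmallCategory C]
  Φ : Mᵒᵖ × Cᵒᵖ × C ⥤ Type u
  φ₀ (A : C) : phiAt Φ (𝟙_ M) A A
  φ {X Y : M} {A B D : C} (q : phiAt Φ Y B D) (p : phiAt Φ X A B) : phiAt Φ (Y ⊗ X) A D
  φ₀_natural {A B : C} (f : A ⟶ B) :
    phiMap Φ (𝟙 (𝟙_ M)) (𝟙 A) f (φ₀ A) = phiMap Φ (𝟙 (𝟙_ M)) f (𝟙 B) (φ₀ B)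
  φ_natural {X X' Y Y' : M} {A A' B D D' : C} (x : X' ⟶ X) (y : Y' ⟶ Y) (a : A' ⟶ A)
    (d : D ⟶ D') (q : phiAt Φ Y B D) (p : phiAt Φ X A B) :
    φ (phiMap Φ y (𝟙 B) d q) (phiMap Φ x a (𝟙 B) p) = phiMap Φ (y ⊗ₘ x) a d (φ q p)
  φ_extranatural {X Y : M} {A B B' D : C} (b : B ⟶ B') (q : phiAt Φ Y B' D)
    (p : phiAt Φ X A B) :
    φ (phiMap Φ (𝟙 Y) b (𝟙 D) q) p = φ q (phiMap Φ (𝟙 X) (𝟙 A) b p)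
  left_unit {X : M} {A B : C} (p : phiAt Φ X A B) :
    φ (φ₀ B) p = phiMap Φ (λ_ X).hom (𝟙 A) (𝟙 B) p
  right_unit {X : M} {A B : C} (p : phiAt Φ X A B) :
    φ p (φ₀ A) = phiMap Φ (ρ_ X).hom (𝟙 A) (𝟙 B) p
  assoc {X Y Z : M} {A B C' D : C} (r : phiAt Φ Z C' D) (q : phiAt Φ Y B C')
    (p : phiAt Φ X A B) :
    phiMap Φ (α_ Z Y X).inv (𝟙 A) (𝟙 D) (φ (φ r q) p) = φ r (φ q p)

attribute [instance] Metamodel.cat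

namespace Metamodel

variable {M : Type u} [SmallCategory M] [MonoidalCategory M]

/-- A 1-cell `(G, g)` of metamodels. -/
@[ext]
structure Hom (P P' : Metamodel M) where
  G : P.C ⥤ P'.C
  g (X : M) (A B : P.C) : phiAt P.Φ X A B → phiAt P'.Φ X (G.obj A) (G.obj B)
  g_natural {X X' : M} {A A' B B' : P.C} (x : X' ⟶ X) (a : A' ⟶ A) (b : B ⟶ B')
    (p : phiAt P.Φ X A B) :
    g X' A' B' (phiMap P.Φ x a b p) = phiMap P'.Φ x (G.map a) (G.map b) (g X A B p)
  unit (A : P.C) : g (𝟙_ M) A A (P.φ₀ A) = P'.φ₀ (G.obj A)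
  comp {X Y : M} {A B D : P.C} (q : phiAt P.Φ Y B D) (p : phiAt P.Φ X A B) :
    g (Y ⊗ X) A D (P.φ q p) = P'.φ (g Y B D q) (g X A B p)

/-- A 2-cell of metamodels. -/
@[ext]
structure Hom₂ {P P' : Metamodel M} (F F' : Hom P P') where
  θ : F.G ⟶ F'.G
  comm {X : M} {A B : P.C} (p : phiAt P.Φ X A B) :
    phiMap P'.Φ (𝟙 X) (𝟙 (F.G.obj A)) (θ.app B) (F.g X A B p) =
      phiMap P'.Φ (𝟙 X) (θ.app A) (𝟙 (F'.G.obj B)) (F'.g X A B p)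

instance (P P' : Metamodel M) : Category (Hom P P') where
  Hom F F' := Hom₂ F F'
  id F := { θ := 𝟙 F.G, comm := fun p => rfl }
  comp {F F' F''} α β :=
    { θ := α.θ ≫ β.θ
      comm := fun {X A B} p => by
        have h1 := phiMap_comp P'.Φ (𝟙 X) (𝟙 X) (𝟙 (F.G.obj A)) (𝟙 (F.G.obj A))
          (α.θ.app B) (β.θ.app B) (F.g X A B p)
        have h2 := phiMap_comp P'.Φ (𝟙 X) (𝟙 X) (β.θ.app A) (α.θ.app A)
          (𝟙 (F''.G.obj B)) (𝟙 (F''.G.obj B)) (F''.g X A B p)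
        have h3 := phiMap_comp P'.Φ (𝟙 X) (𝟙 X) (α.θ.app A) (𝟙 (F.G.obj A))
          (𝟙 (F'.G.obj B)) (β.θ.app B) (F'.g X A B p)
        have h4 := phiMap_comp P'.Φ (𝟙 X) (𝟙 X) (𝟙 (F'.G.obj A)) (α.θ.app A)
          (β.θ.app B) (𝟙 (F''.G.obj B)) (F'.g X A B p)
        simp only [Category.id_comp, Category.comp_id] at h1 h2 h3 h4
        rw [NatTrans.comp_app, NatTrans.comp_app, ← h1, ← h2, α.comm, h3, ← h4, β.comm] }

theorem id_θ_app {P P' : Metamodel M} (F : Hom P P') (A : P.C) :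
    (Hom₂.θ (𝟙 F)).app A = 𝟙 (F.G.obj A) := rfl

theorem comp_θ_app {P P' : Metamodel M} {F F' F'' : Hom P P'} (α : F ⟶ F')
    (β : F' ⟶ F'') (A : P.C) :
    (Hom₂.θ (α ≫ β)).app A = (Hom₂.θ α).app A ≫ (Hom₂.θ β).app A := rfl

theorem hom₂_ext {P P' : Metamodel M} {F F' : Hom P P'} {α β : F ⟶ F'}
    (h : ∀ A, (Hom₂.θ α).app A = (Hom₂.θ β).app A) : α = β :=
  Hom₂.ext (NatTrans.ext (funext h))

theorem eqToHom_θ_app {P P' : Metamodel M} {F F' : Hom P P'} (h : F = F') (A : P.C) :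
    (Hom₂.θ (eqToHom h)).app A = eqToHom (by rw [h]) := by
  subst h; rfl

/-- The identity 1-cell. -/
def Hom.id (P : Metamodel M) : Hom P P where
  G := 𝟭 P.C
  g _ _ _ p := p
  g_natural _ _ _ _ := rfl
  unit _ := rfl
  comp _ _ := rfl

/-- Composition of 1-cells. -/
def Hom.compHom {P P' P'' : Metamodel M} (F : Hom P P') (K : Hom P' P'') : Hom P P'' where
  G := F.G ⋙ K.G
  g X A B p := K.g X (F.G.obj A) (F.G.obj B) (F.g X A B p)
  g_natural x a b p := by rw [F.g_natural, K.g_natural]; rfl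
  unit A := by rw [F.unit, K.unit]; rfl
  comp q p := by rw [F.comp, K.comp]

/-- Whiskering of a 2-cell by a 1-cell on the left. -/
def Hom.whiskerL {P P' P'' : Metamodel M} (F : Hom P P') {K K' : Hom P' P''}
    (β : Hom₂ K K') : Hom₂ (F.compHom K) (F.compHom K') where
  θ := Functor.whiskerLeft F.G β.θ
  comm {X A B} p := β.comm (F.g X A B p)

/-- Whiskering of a 2-cell by a 1-cell on the right. -/
def Hom.whiskerR {P P' P'' : Metamodel M} {F F' : Hom P P'} (α : Hom₂ F F')
    (K : Hom P' P'') : Hom₂ (F.compHom K) (F'.compHom K) where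
  θ := Functor.whiskerRight α.θ K.G
  comm {X A B} p := by
    have h := congrArg (K.g X (F.G.obj A) (F'.G.obj B)) (α.comm p)
    rw [K.g_natural, K.g_natural, CategoryTheory.Functor.map_id,
      CategoryTheory.Functor.map_id] at h
    exact h

theorem Hom.id_compHom {P P' : Metamodel M} (F : Hom P P') :
    (Hom.id P).compHom F = F :=
  Hom.ext rfl HEq.rfl

theorem Hom.compHom_id {P P' : Metamodel M} (F : Hom P P') :
    F.compHom (Hom.id P') = F :=
  Hom.ext rfl HEq.rfl

theorem Hom.compHom_assoc {P₁ P₂ P₃ P₄ : Metamodel M} (F : Hom P₁ P₂) (K : Hom P₂ P₃)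
    (L : Hom P₃ P₄) : (F.compHom K).compHom L = F.compHom (K.compHom L) :=
  Hom.ext rfl HEq.rfl

theorem whiskerL_app {P P' P'' : Metamodel M} (F : Hom P P') {K K' : Hom P' P''}
    (β : K ⟶ K') (A : P.C) :
    (Hom₂.θ (F := F.compHom K) (F' := F.compHom K') (Hom.whiskerL F β)).app A =
      (Hom₂.θ β).app (F.G.obj A) := rfl

theorem whiskerR_app {P P' P'' : Metamodel M} {F F' : Hom P P'} (α : F ⟶ F')
    (K : Hom P' P'') (A : P.C) :
    (Hom₂.θ (F := F.compHom K) (F' := F'.compHom K) (Hom.whiskerR α K)).app A =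
      K.G.map ((Hom₂.θ α).app A) := rfl

theorem id_compHom_app {P P' : Metamodel M} (F : Hom P P') (A : P.C) :
    (Hom₂.θ (eqToHom F.id_compHom)).app A = 𝟙 (F.G.obj A) := eqToHom_θ_app _ _

theorem id_compHom_app' {P P' : Metamodel M} (F : Hom P P') (A : P.C) :
    (Hom₂.θ (eqToHom F.id_compHom.symm)).app A = 𝟙 (F.G.obj A) := eqToHom_θ_app _ _

theorem compHom_id_app {P P' : Metamodel M} (F : Hom P P') (A : P.C) :
    (Hom₂.θ (eqToHom F.compHom_id)).app A = 𝟙 (F.G.obj A) := eqToHom_θ_app _ _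

theorem compHom_id_app' {P P' : Metamodel M} (F : Hom P P') (A : P.C) :
    (Hom₂.θ (eqToHom F.compHom_id.symm)).app A = 𝟙 (F.G.obj A) := eqToHom_θ_app _ _

theorem compHom_assoc_app {P₁ P₂ P₃ P₄ : Metamodel M} (F : Hom P₁ P₂) (K : Hom P₂ P₃)
    (L : Hom P₃ P₄) (A : P₁.C) :
    (Hom₂.θ (eqToHom (Hom.compHom_assoc F K L))).app A = 𝟙 (L.G.obj (K.G.obj (F.G.obj A))) :=
  eqToHom_θ_app _ _

theorem compHom_assoc_app' {P₁ P₂ P₃ P₄ : Metamodel M} (F : Hom P₁ P₂) (K : Hom P₂ P₃)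
    (L : Hom P₃ P₄) (A : P₁.C) :
    (Hom₂.θ (eqToHom (Hom.compHom_assoc F K L).symm)).app A =
      𝟙 (L.G.obj (K.G.obj (F.G.obj A))) :=
  eqToHom_θ_app _ _

set_option linter.unusedSimpArgs false in
/-- Metamodels of `M`, 1-cells and 2-cells form a bicategory, which is a 2-category by the
instance below: its associators and unitors are equalities. -/
instance : Bicategory (Metamodel M) where
  Hom P P' := Hom P P'
  id P := Hom.id P
  comp F K := Hom.compHom F K
  whiskerLeft F _ _ β := Hom.whiskerL F β
  whiskerRight α K := Hom.whiskerR α K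
  associator F K L := eqToIso (Hom.compHom_assoc F K L)
  leftUnitor F := eqToIso (Hom.id_compHom F)
  rightUnitor F := eqToIso (Hom.compHom_id F)
  whiskerLeft_id _ _ := hom₂_ext fun _ => rfl
  whiskerLeft_comp _ _ _ _ _ _ := hom₂_ext fun _ => rfl
  id_whiskerLeft _ := by
    apply hom₂_ext; intro
    simp only [comp_θ_app, whiskerL_app, whiskerR_app, eqToIso.hom, eqToIso.inv, id_compHom_app,
      id_compHom_app', compHom_id_app, compHom_id_app', compHom_assoc_app, compHom_assoc_app']
    exact ((Category.id_comp _).trans (Category.comp_id _)).symm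
  comp_whiskerLeft _ _ _ _ _ := by
    apply hom₂_ext; intro
    simp only [comp_θ_app, whiskerL_app, whiskerR_app, eqToIso.hom, eqToIso.inv, id_compHom_app,
      id_compHom_app', compHom_id_app, compHom_id_app', compHom_assoc_app, compHom_assoc_app']
    exact ((Category.id_comp _).trans (Category.comp_id _)).symm
  id_whiskerRight _ K := hom₂_ext fun _ => K.G.map_id _
  comp_whiskerRight _ _ K := hom₂_ext fun _ => K.G.map_comp _ _
  whiskerRight_id _ := by
    apply hom₂_ext; intro
    simp only [comp_θ_app, whiskerL_app, whiskerR_app, eqToIso.hom, eqToIso.inv, id_compHom_app,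
      id_compHom_app', compHom_id_app, compHom_id_app', compHom_assoc_app, compHom_assoc_app']
    exact ((Category.id_comp _).trans (Category.comp_id _)).symm
  whiskerRight_comp _ _ _ := by
    apply hom₂_ext; intro
    simp only [comp_θ_app, whiskerL_app, whiskerR_app, eqToIso.hom, eqToIso.inv, id_compHom_app,
      id_compHom_app', compHom_id_app, compHom_id_app', compHom_assoc_app, compHom_assoc_app']
    exact ((Category.id_comp _).trans (Category.comp_id _)).symm
  whisker_assoc _ _ _ _ _ := by
    apply hom₂_ext; intro
    simp only [comp_θ_app, whiskerL_app, whiskerR_app, eqToIso.hom, eqToIso.inv, id_compHom_app,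
      id_compHom_app', compHom_id_app, compHom_id_app', compHom_assoc_app, compHom_assoc_app']
    exact ((Category.id_comp _).trans (Category.comp_id _)).symm
  whisker_exchange _ β := hom₂_ext fun _ => ((Hom₂.θ β).naturality _).symm
  pentagon _ _ _ L := by
    apply hom₂_ext; intro
    simp only [comp_θ_app, whiskerL_app, whiskerR_app, eqToIso.hom, eqToIso.inv, id_compHom_app,
      id_compHom_app', compHom_id_app, compHom_id_app', compHom_assoc_app, compHom_assoc_app']
    refine (congrArg (fun t => t ≫ _) (L.G.map_id _)).trans ?_
    exact Category.id_comp _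
  triangle _ K := by
    apply hom₂_ext; intro
    simp only [comp_θ_app, whiskerL_app, whiskerR_app, eqToIso.hom, eqToIso.inv, id_compHom_app,
      id_compHom_app', compHom_id_app, compHom_id_app', compHom_assoc_app, compHom_assoc_app']
    exact (Category.id_comp _).trans (K.G.map_id _).symm

instance : Bicategory.Strict (Metamodel M) where
  id_comp := Hom.id_compHom
  comp_id := Hom.compHom_id
  assoc := Hom.compHom_assoc

end Metamodel

end Metamodel


/-! ## The presheaf category with the convolution monoidal structure -/

section Day

variable (M : Type u) [SmallCategory M] [MonoidalCategory M]

/-- The category `[Mᵒᵖ, Set]` of presheaves on `M`, carrying the Day convolution monoidal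
structure: `Q ⊗ P` is a pointwise left Kan extension of `(Y, X) ↦ Q(Y) × P(X)` along the tensor
product, so that `(Q ⊗ P)(Z)` is the coend over `Y, X` of `M(Z, Y ⊗ X) × Q(Y) × P(X)`. -/
abbrev DayPresheaf : Type (u + 1) := Mᵒᵖ ⊛⥤ Type u

/-- The canonical element of `Î(I)`, where `Î` is the unit object of `DayPresheaf M`. It
corresponds to the identity of `I` under the isomorphism `dayUnitIso` of `Î` with `M(-, I)`. -/
noncomputable def dayUnitElt : (𝟙_ (DayPresheaf M)).functor.obj (op (𝟙_ M)) :=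
  DayFunctor.ν Mᵒᵖ (Type u) PUnit.unit

variable {M}

/-- The coprojection `Q(Y) × P(X) → (Q ⊗ P)(Y ⊗ X)`. -/
noncomputable def dayIn (Q P : DayPresheaf M) {Y X : M} (q : Q.functor.obj (op Y))
    (p : P.functor.obj (op X)) : (Q ⊗ P).functor.obj (op (Y ⊗ X)) :=
  (DayFunctor.η Q P).app (op Y, op X) (q, p)

variable (M) in
/-- The unit object is the representable presheaf `M(-, I)`. -/
noncomputable def dayUnitIso :
    (𝟙_ (DayPresheaf M)).functor ≅ yoneda.obj (𝟙_ M) where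
  hom := (DayFunctor.unitDesc (F := ⟨yoneda.obj (𝟙_ M)⟩) (↾ fun _ => 𝟙 (𝟙_ M))).natTrans
  inv := yonedaEquiv.symm (dayUnitElt M)
  hom_inv_id := by
    have : DayFunctor.unitDesc (F := ⟨yoneda.obj (𝟙_ M)⟩) (↾ fun _ => 𝟙 (𝟙_ M)) ≫
        (⟨yonedaEquiv.symm (dayUnitElt M)⟩ : _ ⟶ 𝟙_ (DayPresheaf M)) = 𝟙 _ := by
      apply DayFunctor.unit_hom_ext
      have h := DayFunctor.ν_comp_unitDesc (C := Mᵒᵖ) (F := ⟨yoneda.obj (𝟙_ M)⟩)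
        (↾ fun _ => 𝟙 (𝟙_ M))
      refine (Category.assoc _ _ _).symm.trans ?_
      refine (congrArg (fun t => t ≫ _) h).trans ?_
      ext x
      exact yonedaEquiv.apply_symm_apply (dayUnitElt M)
    exact congrArg DayFunctor.Hom.natTrans this
  inv_hom_id := by
    apply yonedaEquiv.injective
    have h := DayFunctor.ν_comp_unitDesc (C := Mᵒᵖ) (F := ⟨yoneda.obj (𝟙_ M)⟩)
      (↾ fun _ => 𝟙 (𝟙_ M))
    refine Eq.trans ?_ (ConcreteCategory.congr_hom h PUnit.unit)
    exact congrArg _ (yonedaEquiv.apply_symm_apply (dayUnitElt M))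

theorem dayUnitIso_hom_dayUnitElt :
    (dayUnitIso M).hom.app (op (𝟙_ M)) (dayUnitElt M) = 𝟙 (𝟙_ M) :=
  ConcreteCategory.congr_hom (DayFunctor.ν_comp_unitDesc (C := Mᵒᵖ)
    (F := ⟨yoneda.obj (𝟙_ M)⟩) (↾ fun _ => 𝟙 (𝟙_ M))) PUnit.unit

theorem dayIn_map (Q P : DayPresheaf M) {Y Y' X X' : M} (y : Y' ⟶ Y) (x : X' ⟶ X)
    (q : Q.functor.obj (op Y)) (p : P.functor.obj (op X)) :
    dayIn Q P (Q.functor.map y.op q) (P.functor.map x.op p) =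
      (Q ⊗ P).functor.map (y ⊗ₘ x).op (dayIn Q P q p) := by
  have h := (DayFunctor.η Q P).naturality (y.op ×ₘ x.op : (op Y, op X) ⟶ (op Y', op X'))
  let t : Q.functor.obj (op Y) × P.functor.obj (op X) := (q, p)
  exact ConcreteCategory.congr_hom h t

theorem dayIn_tensorHom {Q Q' P P' : DayPresheaf M} (f : Q ⟶ Q') (g : P ⟶ P') {Y X : M}
    (q : Q.functor.obj (op Y)) (p : P.functor.obj (op X)) :
    (f ⊗ₘ g).natTrans.app (op (Y ⊗ X)) (dayIn Q P q p) =
      dayIn Q' P' (f.natTrans.app _ q) (g.natTrans.app _ p) := by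
  let t : Q.functor.obj (op Y) × P.functor.obj (op X) := (q, p)
  exact ConcreteCategory.congr_hom
    (LawfulDayConvolutionMonoidalCategoryStruct.convolutionExtensionUnit_comp_ι_map_tensorHom_app
      Mᵒᵖ (Type u) f g (op Y) (op X)) t

theorem dayIn_whiskerLeft (Q : DayPresheaf M) {P P' : DayPresheaf M} (g : P ⟶ P') {Y X : M}
    (q : Q.functor.obj (op Y)) (p : P.functor.obj (op X)) :
    (Q ◁ g).natTrans.app (op (Y ⊗ X)) (dayIn Q P q p) = dayIn Q P' q (g.natTrans.app _ p) := by
  let t : Q.functor.obj (op Y) × P.functor.obj (op X) := (q, p)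
  exact ConcreteCategory.congr_hom
    (LawfulDayConvolutionMonoidalCategoryStruct.convolutionExtensionUnit_comp_ι_map_whiskerLeft_app
      (Type u) Q g (op Y) (op X)) t

theorem dayIn_whiskerRight {Q Q' : DayPresheaf M} (f : Q ⟶ Q') (P : DayPresheaf M) {Y X : M}
    (q : Q.functor.obj (op Y)) (p : P.functor.obj (op X)) :
    (f ▷ P).natTrans.app (op (Y ⊗ X)) (dayIn Q P q p) = dayIn Q' P (f.natTrans.app _ q) p := by
  let t : Q.functor.obj (op Y) × P.functor.obj (op X) := (q, p)
  exact ConcreteCategory.congr_hom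
    (LawfulDayConvolutionMonoidalCategoryStruct.convolutionExtensionUnit_comp_ι_map_whiskerRight_app
      Mᵒᵖ (Type u) f P (op Y) (op X)) t

theorem dayIn_associator (R Q P : DayPresheaf M) {Z Y X : M} (r : R.functor.obj (op Z))
    (q : Q.functor.obj (op Y)) (p : P.functor.obj (op X)) :
    (α_ R Q P).hom.natTrans.app (op ((Z ⊗ Y) ⊗ X)) (dayIn (R ⊗ Q) P (dayIn R Q r q) p) =
      (R ⊗ Q ⊗ P).functor.map (α_ Z Y X).hom.op (dayIn R (Q ⊗ P) r (dayIn Q P q p)) := by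
  let t : (R.functor.obj (op Z) × Q.functor.obj (op Y)) × P.functor.obj (op X) := ((r, q), p)
  exact ConcreteCategory.congr_hom
    (LawfulDayConvolutionMonoidalCategoryStruct.associator_hom_unit_unit (C := Mᵒᵖ)
      (Type u) R Q P (op Z) (op Y) (op X)) t

theorem dayIn_leftUnitor (P : DayPresheaf M) {X : M} (p : P.functor.obj (op X)) :
    (λ_ P).hom.natTrans.app (op (𝟙_ M ⊗ X)) (dayIn (𝟙_ _) P (dayUnitElt M) p) =
      P.functor.map (λ_ X).hom.op p := by
  let t : PUnit × P.functor.obj (op X) := (PUnit.unit, p)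
  exact ConcreteCategory.congr_hom
    (LawfulDayConvolutionMonoidalCategoryStruct.leftUnitor_hom_unit_app (C := Mᵒᵖ)
      (Type u) P (op X)) t

theorem dayIn_rightUnitor (P : DayPresheaf M) {X : M} (p : P.functor.obj (op X)) :
    (ρ_ P).hom.natTrans.app (op (X ⊗ 𝟙_ M)) (dayIn P (𝟙_ _) p (dayUnitElt M)) =
      P.functor.map (ρ_ X).hom.op p := by
  let t : P.functor.obj (op X) × PUnit := (p, PUnit.unit)
  exact ConcreteCategory.congr_hom
    (LawfulDayConvolutionMonoidalCategoryStruct.rightUnitor_hom_unit_app (C := Mᵒᵖ)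
      (Type u) P (op X)) t

end Day

/-! ## The comparison 2-functor -/

section Comparison

variable {M : Type u} [SmallCategory M] [MonoidalCategory M]

/-- The functor `(X, A, B) ↦ ⟨A, B⟩(X)`. -/
@[simps]
def uncurryHom {C : Type u} [SmallCategory C] (H : Cᵒᵖ × C ⥤ DayPresheaf M) :
    Mᵒᵖ × Cᵒᵖ × C ⥤ Type u where
  obj t := (H.obj t.2).functor.obj t.1
  map {_ t'} f := (H.map f.2).natTrans.app _ ≫ (H.obj t'.2).functor.map f.1
  map_id t := by
    rw [prod_id]; simp
  map_comp {X Y Z} f g := by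
    have h : H.map (f ≫ g).2 = H.map f.2 ≫ H.map g.2 := H.map_comp f.2 g.2
    rw [h]; simp

theorem phiMap_uncurryHom {C : Type u} [SmallCategory C] (H : Cᵒᵖ × C ⥤ DayPresheaf M)
    {X X' : M} {A A' B B' : C} (x : X' ⟶ X) (a : A' ⟶ A) (b : B ⟶ B')
    (p : (homAt H A B).functor.obj (op X)) :
    phiMap (uncurryHom H) x a b p =
      (homAt H A' B').functor.map x.op ((homMap H a b).natTrans.app (op X) p) := rfl

theorem natTrans_app_congr {F G : DayPresheaf M} {α β : F ⟶ G} (h : α = β) {X : Mᵒᵖ}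
    (p : F.functor.obj X) : α.natTrans.app X p = β.natTrans.app X p := by rw [h]

theorem natTrans_naturality {F G : DayPresheaf M} (α : F ⟶ G) {X Y : Mᵒᵖ} (f : X ⟶ Y)
    (p : F.functor.obj X) :
    α.natTrans.app Y (F.functor.map f p) = G.functor.map f (α.natTrans.app X p) :=
  NatTrans.naturality_apply α.natTrans f p

theorem functor_map_id_apply (F : DayPresheaf M) {X : M} (p : F.functor.obj (op X)) :
    F.functor.map (𝟙 X).op p = p :=
  ConcreteCategory.congr_hom (F.functor.map_id (op X)) p

theorem homMap_id_app {C : Type u} [SmallCategory C] (H : Cᵒᵖ × C ⥤ DayPresheaf M) {A B : C}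
    {X : Mᵒᵖ} (p : (homAt H A B).functor.obj X) :
    (homMap H (𝟙 A) (𝟙 B)).natTrans.app X p = p :=
  natTrans_app_congr (homMap_id H A B) p

namespace Enrichment

variable (E : Enrichment.{u} (DayPresheaf M))

/-- The element of `⟨A, A⟩(I)` which corresponds to `j A : M(-, I) ⟶ ⟨A, A⟩` under the Yoneda
lemma. -/
noncomputable def jElt (A : E.C) : (homAt E.H A A).functor.obj (op (𝟙_ M)) :=
  (E.j A).natTrans.app (op (𝟙_ M)) (dayUnitElt M)

/-- The restriction of `M A B D` along the coprojection
`⟨B, D⟩(Y) × ⟨A, B⟩(X) → (⟨B, D⟩ ⊗ ⟨A, B⟩)(Y ⊗ X)` of the coend. -/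
noncomputable def mElt {Y X : M} {A B D : E.C} (q : (homAt E.H B D).functor.obj (op Y))
    (p : (homAt E.H A B).functor.obj (op X)) : (homAt E.H A D).functor.obj (op (Y ⊗ X)) :=
  (E.M A B D).natTrans.app (op (Y ⊗ X)) (dayIn (homAt E.H B D) (homAt E.H A B) q p)

theorem jElt_natural {A B : E.C} (f : A ⟶ B) :
    (homAt E.H A B).functor.map (𝟙 (𝟙_ M)).op
        ((homMap E.H (𝟙 A) f).natTrans.app _ (E.jElt A)) =
      (homAt E.H A B).functor.map (𝟙 (𝟙_ M)).op
        ((homMap E.H f (𝟙 B)).natTrans.app _ (E.jElt B)) :=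
  congrArg _ (natTrans_app_congr (E.j_natural f) (dayUnitElt M))

theorem mElt_natural {X X' Y Y' : M} {A A' B D D' : E.C} (x : X' ⟶ X) (y : Y' ⟶ Y)
    (a : A' ⟶ A) (d : D ⟶ D') (q : (homAt E.H B D).functor.obj (op Y))
    (p : (homAt E.H A B).functor.obj (op X)) :
    E.mElt ((homAt E.H B D').functor.map y.op ((homMap E.H (𝟙 B) d).natTrans.app _ q))
        ((homAt E.H A' B).functor.map x.op ((homMap E.H a (𝟙 B)).natTrans.app _ p)) =
      (homAt E.H A' D').functor.map (y ⊗ₘ x).op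
        ((homMap E.H a d).natTrans.app _ (E.mElt q p)) := by
  rw [mElt, dayIn_map, natTrans_naturality, ← dayIn_tensorHom]
  exact congrArg _ (natTrans_app_congr (E.M_natural B a d) (dayIn _ _ q p))

theorem mElt_extranatural {X Y : M} {A B B' D : E.C} (b : B ⟶ B')
    (q : (homAt E.H B' D).functor.obj (op Y)) (p : (homAt E.H A B).functor.obj (op X)) :
    E.mElt ((homAt E.H B D).functor.map (𝟙 Y).op ((homMap E.H b (𝟙 D)).natTrans.app _ q)) p =
      E.mElt q
        ((homAt E.H A B').functor.map (𝟙 X).op ((homMap E.H (𝟙 A) b).natTrans.app _ p)) := by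
  rw [functor_map_id_apply, functor_map_id_apply, mElt, mElt, ← dayIn_whiskerRight,
    ← dayIn_whiskerLeft]
  exact natTrans_app_congr (E.M_extranatural A D b) (dayIn _ _ q p)

theorem mElt_left_unit {X : M} {A B : E.C} (p : (homAt E.H A B).functor.obj (op X)) :
    E.mElt (E.jElt B) p = (homAt E.H A B).functor.map (λ_ X).hom.op
      ((homMap E.H (𝟙 A) (𝟙 B)).natTrans.app _ p) := by
  rw [homMap_id_app, ← dayIn_leftUnitor, mElt, jElt, ← dayIn_whiskerRight]
  exact natTrans_app_congr (E.left_unit A B) (dayIn _ _ (dayUnitElt M) p)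

theorem mElt_right_unit {X : M} {A B : E.C} (p : (homAt E.H A B).functor.obj (op X)) :
    E.mElt p (E.jElt A) = (homAt E.H A B).functor.map (ρ_ X).hom.op
      ((homMap E.H (𝟙 A) (𝟙 B)).natTrans.app _ p) := by
  rw [homMap_id_app, ← dayIn_rightUnitor, mElt, jElt, ← dayIn_whiskerLeft]
  exact natTrans_app_congr (E.right_unit A B) (dayIn _ _ p (dayUnitElt M))

theorem mElt_assoc {X Y Z : M} {A B C' D : E.C} (r : (homAt E.H C' D).functor.obj (op Z))
    (q : (homAt E.H B C').functor.obj (op Y)) (p : (homAt E.H A B).functor.obj (op X)) :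
    (homAt E.H A D).functor.map (α_ Z Y X).inv.op
        ((homMap E.H (𝟙 A) (𝟙 D)).natTrans.app _ (E.mElt (E.mElt r q) p)) =
      E.mElt r (E.mElt q p) := by
  rw [homMap_id_app]
  have h := natTrans_app_congr (E.assoc A B C' D) (dayIn _ _ (dayIn _ _ r q) p)
  have h1 : E.mElt (E.mElt r q) p = (homAt E.H A D).functor.map (α_ Z Y X).hom.op
      (E.mElt r (E.mElt q p)) := by
    unfold mElt
    rw [← dayIn_whiskerRight, ← dayIn_whiskerLeft, ← natTrans_naturality,
      ← natTrans_naturality, ← dayIn_associator]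
    exact h
  rw [h1, ← Functor.map_comp_apply, ← op_comp, Iso.inv_hom_id]
  exact functor_map_id_apply _ _

/-- The metamodel in `C` which corresponds to an enrichment of `C` over `DayPresheaf M`, given by
`Φ_X(A, B) = ⟨A, B⟩(X)` and by the transposes of `j` and `M`. -/
noncomputable def toMetamodel : Metamodel M where
  C := E.C
  Φ := uncurryHom E.H
  φ₀ A := E.jElt A
  φ q p := E.mElt q p
  φ₀_natural f := E.jElt_natural f
  φ_natural x y a d q p := E.mElt_natural x y a d q p
  φ_extranatural b q p := E.mElt_extranatural b q p
  left_unit p := E.mElt_left_unit p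
  right_unit p := E.mElt_right_unit p
  assoc r q p := E.mElt_assoc r q p

variable {E} {E' : Enrichment.{u} (DayPresheaf M)}

theorem Hom.app_natural (F : Hom E E') {X X' : M} {A A' B B' : E.C} (x : X' ⟶ X) (a : A' ⟶ A)
    (b : B ⟶ B') (p : (homAt E.H A B).functor.obj (op X)) :
    (F.g A' B').natTrans.app (op X') ((homAt E.H A' B').functor.map x.op
        ((homMap E.H a b).natTrans.app (op X) p)) =
      (homAt E'.H (F.G.obj A') (F.G.obj B')).functor.map x.op
        ((homMap E'.H (F.G.map a) (F.G.map b)).natTrans.app (op X)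
          ((F.g A B).natTrans.app (op X) p)) := by
  rw [natTrans_naturality]
  exact congrArg _ (natTrans_app_congr (F.g_natural a b) p)

theorem Hom.app_jElt (F : Hom E E') (A : E.C) :
    (F.g A A).natTrans.app (op (𝟙_ M)) (E.jElt A) = E'.jElt (F.G.obj A) :=
  natTrans_app_congr (F.unit A) (dayUnitElt M)

theorem Hom.app_mElt (F : Hom E E') {X Y : M} {A B D : E.C}
    (q : (homAt E.H B D).functor.obj (op Y)) (p : (homAt E.H A B).functor.obj (op X)) :
    (F.g A D).natTrans.app (op (Y ⊗ X)) (E.mElt q p) =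
      E'.mElt ((F.g B D).natTrans.app (op Y) q) ((F.g A B).natTrans.app (op X) p) := by
  unfold mElt
  rw [← dayIn_tensorHom]
  exact natTrans_app_congr (F.comp A B D) (dayIn _ _ q p)

/-- The action of the comparison on 1-cells: `(G, g) ↦ (G, g)`. -/
noncomputable def Hom.toMetamodel (F : Hom E E') :
    Metamodel.Hom E.toMetamodel E'.toMetamodel where
  G := F.G
  g X A B p := (F.g A B).natTrans.app (op X) p
  g_natural x a b p := F.app_natural x a b p
  unit A := F.app_jElt A
  comp q p := F.app_mElt q p

theorem Hom₂.app_comm {F F' : Hom E E'} (α : Hom₂ F F') {X : M} {A B : E.C}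
    (p : (homAt E.H A B).functor.obj (op X)) :
    (homAt E'.H (F.G.obj A) (F'.G.obj B)).functor.map (𝟙 X).op
        ((homMap E'.H (𝟙 (F.G.obj A)) (α.θ.app B)).natTrans.app (op X)
          ((F.g A B).natTrans.app (op X) p)) =
      (homAt E'.H (F.G.obj A) (F'.G.obj B)).functor.map (𝟙 X).op
        ((homMap E'.H (α.θ.app A) (𝟙 (F'.G.obj B))).natTrans.app (op X)
          ((F'.g A B).natTrans.app (op X) p)) :=
  congrArg _ (natTrans_app_congr (α.comm A B) p)

/-- The action of the comparison on 2-cells: `θ ↦ θ`. -/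
noncomputable def Hom₂.toMetamodel {F F' : Hom E E'} (α : Hom₂ F F') :
    Metamodel.Hom₂ F.toMetamodel F'.toMetamodel where
  θ := α.θ
  comm p := α.app_comm p

end Enrichment

variable (M) in
/-- The canonical 2-functor from enrichments over `DayPresheaf M` to metamodels of `M`. -/
noncomputable def enrichToMtMod :
    StrictPseudofunctor (Enrichment.{u} (DayPresheaf M)) (Metamodel M) :=
  StrictPseudofunctor.mk''
    { obj := fun E => E.toMetamodel
      map := fun F => F.toMetamodel
      map₂ := fun α => α.toMetamodel
      map₂_id := fun _ => rfl
      map₂_comp := fun _ _ => rfl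
      map_id := fun _ => rfl
      map_comp := fun _ _ => rfl
      map₂_whisker_left := fun _ _ _ _ => by
        apply Metamodel.hom₂_ext; intro
        exact ((Category.id_comp _).trans (Category.comp_id _)).symm
      map₂_whisker_right := fun _ _ => by
        apply Metamodel.hom₂_ext; intro
        exact ((Category.id_comp _).trans (Category.comp_id _)).symm }

end Comparison

/-- A 2-functor is an isomorphism of 2-categories if it is bijective on objects and induces
isomorphisms between hom-categories, that is, is bijective on 1-cells and on 2-cells. -/
structure CategoryTheory.StrictPseudofunctor.IsIsomorphism {B : Type*} [Bicategory B]
    {C : Type*} [Bicategory C] (F : StrictPseudofunctor B C) : Prop where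
  bijective_obj : Function.Bijective F.obj
  bijective_map (a b : B) : Function.Bijective (fun f : a ⟶ b => F.map f)
  bijective_map₂ {a b : B} (f g : a ⟶ b) : Function.Bijective (fun η : f ⟶ g => F.map₂ η)

/-! ### Generators of the Day convolution and its universal property, in terms of elements -/

section DayPresheaf

variable {M : Type u} [SmallCategory M] [MonoidalCategory M]

/-! Both sides carry the same data, read through three bijections. Currying identifies functors on
`Mᵒᵖ × Cᵒᵖ × C` with presheaf-valued functors on `Cᵒᵖ × C`. By the Yoneda lemma, a morphism from the
unit presheaf to `F` is an element of `F(I)`. By the universal property of the coend, a morphism `Q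
⊗ P ⟶ F` is a family of functions `Q(Y) × P(X) → F(Y ⊗ X)` natural in `Y` and `X`. The first
bijection matches `H` with `Φ`, the second `j` with `φ₀`, the third `M` with `φ`.

The axioms match for the same reason. Each enrichment axiom equates two morphisms out of a hom
presheaf, the unit, or a convolution of these, and such morphisms agree as soon as they agree on
generators: on `dayUnitElt`, on elements `dayIn q p`, or on iterates of these (`dayUnit_hom_ext`,
`dayTensor_hom_ext` and their variants). Evaluated on generators, the enrichment axioms become the
metamodel axioms.

The result is an isomorphism, not only an equivalence, because currying is bijective up to equality
of functors (`uncurryHom_curryHom`, `curryHom_uncurryHom`), and once `H` is fixed the bijections for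
`j` and `M` are bijections of sets. On 1-cells, the maps `g` are likewise families of presheaf
components; on 2-cells only the form of the compatibility equation changes. -/

/-- Every element of `(Q ⊗ P)(Z)` is represented in the coend by elements of `Q(Y)` and `P(X)`
and a morphism `Z ⟶ Y ⊗ X`. -/
theorem exists_map_dayIn (Q P : DayPresheaf M) {Z : M} (s : (Q ⊗ P).functor.obj (op Z)) :
    ∃ (Y X : M) (z : Z ⟶ Y ⊗ X) (q : Q.functor.obj (op Y)) (p : P.functor.obj (op X)),
      (Q ⊗ P).functor.map z.op (dayIn Q P q p) = s := by
  -- The value at `Z` is a colimit indexed by arrows `op (Y ⊗ X) ⟶ op Z`, so an index `k` supplies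
  -- `Y`, `X` and, after `unop`, the morphism `z`.
  obtain ⟨k, ⟨q, p⟩, h⟩ := Limits.Types.jointly_surjective_of_isColimit
    (LawfulDayConvolutionMonoidalCategoryStruct.isPointwiseLeftKanExtensionConvolutionExtensionUnit
      (C := Mᵒᵖ) (V := Type u) Q P (op Z)) s
  exact ⟨k.left.1.unop, k.left.2.unop, k.hom.unop, q, p, h⟩

/-- Every element of the unit presheaf is a restriction of `dayUnitElt`. -/
theorem exists_map_dayUnitElt {Z : M} (s : (𝟙_ (DayPresheaf M)).functor.obj (op Z)) :
    ∃ z : Z ⟶ 𝟙_ M, (𝟙_ (DayPresheaf M)).functor.map z.op (dayUnitElt M) = s := by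
  refine ⟨(dayUnitIso M).hom.app (op Z) s, ?_⟩
  exact ConcreteCategory.congr_hom ((dayUnitIso M).hom_inv_id_app (op Z)) s

theorem dayPresheaf_hom_ext {F G : DayPresheaf M} {α β : F ⟶ G}
    (h : ∀ (X : M) (p : F.functor.obj (op X)),
      α.natTrans.app (op X) p = β.natTrans.app (op X) p) : α = β := by
  apply DayFunctor.hom_ext
  ext X p
  exact h X.unop p

/-- Uniqueness half of the Yoneda correspondence: `dayUnitElt` generates the unit presheaf under
restriction. -/
theorem dayUnit_hom_ext {F : DayPresheaf M} {α β : 𝟙_ (DayPresheaf M) ⟶ F}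
    (h : α.natTrans.app _ (dayUnitElt M) = β.natTrans.app _ (dayUnitElt M)) : α = β := by
  apply dayPresheaf_hom_ext
  intro X s
  obtain ⟨z, rfl⟩ := exists_map_dayUnitElt s
  rw [natTrans_naturality, natTrans_naturality, h]

/-- Uniqueness half of the coend's universal property: every element is a restriction of some `dayIn
q p`, and both morphisms commute with restriction. -/
theorem dayTensor_hom_ext {Q P F : DayPresheaf M} {α β : Q ⊗ P ⟶ F}
    (h : ∀ (Y X : M) (q : Q.functor.obj (op Y)) (p : P.functor.obj (op X)),
      α.natTrans.app _ (dayIn Q P q p) = β.natTrans.app _ (dayIn Q P q p)) : α = β := by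
  apply dayPresheaf_hom_ext
  intro Z s
  obtain ⟨Y, X, z, q, p, rfl⟩ := exists_map_dayIn Q P s
  rw [natTrans_naturality, natTrans_naturality, h]

theorem dayIn_map_left (Q P : DayPresheaf M) {Y Y' X : M} (y : Y' ⟶ Y)
    (q : Q.functor.obj (op Y)) (p : P.functor.obj (op X)) :
    dayIn Q P (Q.functor.map y.op q) p =
      (Q ⊗ P).functor.map (y ⊗ₘ 𝟙 X).op (dayIn Q P q p) := by
  rw [← dayIn_map, functor_map_id_apply]

theorem dayIn_map_right (Q P : DayPresheaf M) {Y X X' : M} (x : X' ⟶ X)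
    (q : Q.functor.obj (op Y)) (p : P.functor.obj (op X)) :
    dayIn Q P q (P.functor.map x.op p) =
      (Q ⊗ P).functor.map (𝟙 Y ⊗ₘ x).op (dayIn Q P q p) := by
  rw [← dayIn_map, functor_map_id_apply]

/-- A restriction in the unit factor can be pulled out of `dayIn`, so the generator suffices there.
This is the test for the left unit law. -/
theorem dayUnitTensor_hom_ext {P F : DayPresheaf M} {α β : 𝟙_ (DayPresheaf M) ⊗ P ⟶ F}
    (h : ∀ (X : M) (p : P.functor.obj (op X)),
      α.natTrans.app _ (dayIn _ P (dayUnitElt M) p) =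
        β.natTrans.app _ (dayIn _ P (dayUnitElt M) p)) : α = β := by
  apply dayTensor_hom_ext
  intro Y X s p
  obtain ⟨z, rfl⟩ := exists_map_dayUnitElt s
  rw [dayIn_map_left, natTrans_naturality, natTrans_naturality, h]

theorem dayTensorUnit_hom_ext {P F : DayPresheaf M} {α β : P ⊗ 𝟙_ (DayPresheaf M) ⟶ F}
    (h : ∀ (X : M) (p : P.functor.obj (op X)),
      α.natTrans.app _ (dayIn P _ p (dayUnitElt M)) =
        β.natTrans.app _ (dayIn P _ p (dayUnitElt M))) : α = β := by
  apply dayTensor_hom_ext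
  intro Y X p s
  obtain ⟨z, rfl⟩ := exists_map_dayUnitElt s
  rw [dayIn_map_right, natTrans_naturality, natTrans_naturality, h]

/-- Test for associativity: the coend argument is applied to the outer convolution, then to its left
factor, whose restriction is pulled out. -/
theorem dayTensorTensor_hom_ext {R Q P F : DayPresheaf M} {α β : (R ⊗ Q) ⊗ P ⟶ F}
    (h : ∀ (Z Y X : M) (r : R.functor.obj (op Z)) (q : Q.functor.obj (op Y))
      (p : P.functor.obj (op X)),
      α.natTrans.app _ (dayIn (R ⊗ Q) P (dayIn R Q r q) p) =
        β.natTrans.app _ (dayIn (R ⊗ Q) P (dayIn R Q r q) p)) : α = β := by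
  apply dayTensor_hom_ext
  intro W X s p
  obtain ⟨Z, Y, z, r, q, rfl⟩ := exists_map_dayIn R Q s
  rw [dayIn_map_left, natTrans_naturality, natTrans_naturality, h]

theorem functor_map_hom_map_inv (F : DayPresheaf M) {X Y : M} (e : X ≅ Y)
    (p : F.functor.obj (op X)) : F.functor.map e.hom.op (F.functor.map e.inv.op p) = p := by
  rw [← Functor.map_comp_apply, ← op_comp, Iso.hom_inv_id, functor_map_id_apply]

/-- The morphism out of the unit presheaf which corresponds to an element of `F(I)`. -/
noncomputable def dayUnitDesc {F : DayPresheaf M} (t : F.functor.obj (op (𝟙_ M))) :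
    𝟙_ (DayPresheaf M) ⟶ F :=
  DayFunctor.unitDesc (↾ fun _ => t)

/-- Existence half of the Yoneda correspondence, complementing `dayUnit_hom_ext`. -/
theorem dayUnitDesc_dayUnitElt {F : DayPresheaf M} (t : F.functor.obj (op (𝟙_ M))) :
    (dayUnitDesc t).natTrans.app _ (dayUnitElt M) = t :=
  ConcreteCategory.congr_hom (DayFunctor.ν_comp_unitDesc (C := Mᵒᵖ) (F := F) (↾ fun _ => t))
    PUnit.unit

/-- The morphism out of a convolution which corresponds to a natural family of functions
`Q(Y) × P(X) → F(Y ⊗ X)`. -/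
noncomputable def dayDesc {Q P F : DayPresheaf M}
    (f : ∀ {Y X : M}, Q.functor.obj (op Y) → P.functor.obj (op X) → F.functor.obj (op (Y ⊗ X)))
    (hf : ∀ {Y Y' X X' : M} (y : Y' ⟶ Y) (x : X' ⟶ X) (q : Q.functor.obj (op Y))
      (p : P.functor.obj (op X)),
      f (Q.functor.map y.op q) (P.functor.map x.op p) = F.functor.map (y ⊗ₘ x).op (f q p)) :
    Q ⊗ P ⟶ F :=
  DayFunctor.tensorDesc
    { app := fun t => ↾ fun s : Q.functor.obj (op t.1.unop) × P.functor.obj (op t.2.unop) =>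
        f s.1 s.2
      naturality := fun t t' k => by
        ext s
        exact hf k.1.unop k.2.unop s.1 s.2 }

/-- Existence half of the coend's universal property, complementing `dayTensor_hom_ext`. -/
theorem dayDesc_dayIn {Q P F : DayPresheaf M}
    (f : ∀ {Y X : M}, Q.functor.obj (op Y) → P.functor.obj (op X) → F.functor.obj (op (Y ⊗ X)))
    (hf : ∀ {Y Y' X X' : M} (y : Y' ⟶ Y) (x : X' ⟶ X) (q : Q.functor.obj (op Y))
      (p : P.functor.obj (op X)),
      f (Q.functor.map y.op q) (P.functor.map x.op p) = F.functor.map (y ⊗ₘ x).op (f q p))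
    {Y X : M} (q : Q.functor.obj (op Y)) (p : P.functor.obj (op X)) :
    (dayDesc f hf).natTrans.app _ (dayIn Q P q p) = f q p := by
  let t : Q.functor.obj (op Y) × P.functor.obj (op X) := (q, p)
  exact ConcreteCategory.congr_hom
    (DayFunctor.η_comp_tensorDesc_app (F := Q) (G := P) (H := F) _ (op Y) (op X)) t

end DayPresheaf

/-! ### Currying as a strict bijection on functors -/

section Uncurry

variable {M : Type u} [SmallCategory M] [MonoidalCategory M] {C : Type u} [SmallCategory C]

/-- The functor `(A, B) ↦ Φ_(-)(A, B)`. -/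
def curryHom (Φ : Mᵒᵖ × Cᵒᵖ × C ⥤ Type u) : Cᵒᵖ × C ⥤ DayPresheaf M where
  obj t :=
    ⟨{ obj := fun X => Φ.obj (X, t)
       map := fun {X X'} x => Φ.map (x ×ₘ 𝟙 t : (X, t) ⟶ (X', t))
       map_id := fun X => Φ.map_id (X, t)
       map_comp := fun {X X' X''} x x' => by rw [← Φ.map_comp, prod_comp, Category.comp_id] }⟩
  map {t t'} f :=
    ⟨{ app := fun X => Φ.map (𝟙 X ×ₘ f : (X, t) ⟶ (X, t'))
       naturality := fun X X' x =>
        (Φ.map_comp (x ×ₘ 𝟙 t : (X, t) ⟶ (X', t)) (𝟙 X' ×ₘ f : (X', t) ⟶ (X', t'))).symm.trans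
          ((congrArg Φ.map (Prod.ext ((Category.comp_id x).trans (Category.id_comp x).symm)
            ((Category.id_comp f).trans (Category.comp_id f).symm))).trans
          (Φ.map_comp (𝟙 X ×ₘ f : (X, t) ⟶ (X, t')) (x ×ₘ 𝟙 t' : (X, t') ⟶ (X', t')))) }⟩
  map_id t := by
    apply DayFunctor.hom_ext
    ext1; ext1 X
    exact Φ.map_id (X, t)
  map_comp {t t' t''} f g := by
    apply DayFunctor.hom_ext
    ext1; ext1 X
    refine Eq.trans ?_ (Φ.map_comp (𝟙 X ×ₘ f : (X, t) ⟶ (X, t')) (𝟙 X ×ₘ g : (X, t') ⟶ (X, t'')))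
    exact congrArg Φ.map (Prod.ext (Category.comp_id (𝟙 X)).symm rfl)

theorem uncurryHom_curryHom (Φ : Mᵒᵖ × Cᵒᵖ × C ⥤ Type u) : uncurryHom (curryHom Φ) = Φ := by
  refine CategoryTheory.Functor.ext (fun _ => rfl) fun t t' f => ?_
  refine Eq.trans ?_ ((Category.id_comp _).trans (Category.comp_id _)).symm
  -- Uncurrying splits `f` into its `C`-part followed by its `M`-part; functoriality of `Φ`
  -- recombines them.
  refine (Φ.map_comp (𝟙 t.1 ×ₘ f.2 : (t.1, t.2) ⟶ (t.1, t'.2))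
    (f.1 ×ₘ 𝟙 t'.2 : (t.1, t'.2) ⟶ (t'.1, t'.2))).symm.trans ?_
  exact congrArg Φ.map (Prod.ext (Category.id_comp f.1) (Category.comp_id f.2))

/-- This and the next lemma separate the action of `C` from restriction along `M`. They split the
joint naturality of a metamodel into naturality of presheaf morphisms and naturality of the families
in the objects of `C`. -/
theorem phiMap_uncurryHom_id (H : Cᵒᵖ × C ⥤ DayPresheaf M) {X : M} {A A' B B' : C}
    (a : A' ⟶ A) (b : B ⟶ B') (p : phiAt (uncurryHom H) X A B) :
    phiMap (uncurryHom H) (𝟙 X) a b p = (homMap H a b).natTrans.app (op X) p :=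
  functor_map_id_apply _ _

theorem phiMap_uncurryHom_id_id (H : Cᵒᵖ × C ⥤ DayPresheaf M) {X X' : M} {A B : C}
    (x : X' ⟶ X) (p : phiAt (uncurryHom H) X A B) :
    phiMap (uncurryHom H) x (𝟙 A) (𝟙 B) p = (homAt H A B).functor.map x.op p :=
  congrArg ((homAt H A B).functor.map x.op) (homMap_id_app H p)

/-- The two presheaves have the same values, but restriction on the left carries an extra factor
`H.map (𝟙 t)`, so the equality is not definitional. -/
theorem curryHom_uncurryHom_obj (H : Cᵒᵖ × C ⥤ DayPresheaf M) (t : Cᵒᵖ × C) :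
    (curryHom (uncurryHom H)).obj t = H.obj t := by
  refine congrArg DayFunctor.mk (CategoryTheory.Functor.ext (fun _ => rfl) fun X X' x => ?_)
  refine Eq.trans ?_ ((Category.id_comp _).trans (Category.comp_id _)).symm
  refine (congrArg (fun k : H.obj t ⟶ H.obj t => k.natTrans.app X ≫ (H.obj t).functor.map x)
    (H.map_id t)).trans ?_
  exact Category.id_comp _

/-- Needed to compare the actions of two functors on morphisms when their values on objects are
equal only propositionally. -/
theorem dayPresheaf_hom_heq {F F' G G' : DayPresheaf M} (hF : F = F') (hG : G = G')
    {α : F ⟶ G} {β : F' ⟶ G'} (h : ∀ X, α.natTrans.app X ≍ β.natTrans.app X) : α ≍ β := by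
  subst hF hG
  exact heq_of_eq (DayFunctor.hom_ext (NatTrans.ext (funext fun X => eq_of_heq (h X))))

theorem curryHom_uncurryHom (H : Cᵒᵖ × C ⥤ DayPresheaf M) : curryHom (uncurryHom H) = H := by
  refine Functor.hext (curryHom_uncurryHom_obj H) fun t t' f => ?_
  -- Componentwise the sources and targets are definitionally the same sets, so an ordinary equality
  -- suffices.
  refine dayPresheaf_hom_heq (curryHom_uncurryHom_obj H t) (curryHom_uncurryHom_obj H t')
    fun X => heq_of_eq ?_
  refine (congrArg (fun k => (H.map f).natTrans.app X ≫ k) ((H.obj t').functor.map_id X)).trans ?_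
  exact Category.comp_id _

theorem uncurryHom_injective :
    Function.Injective (uncurryHom : (Cᵒᵖ × C ⥤ DayPresheaf M) → _) :=
  Function.LeftInverse.injective curryHom_uncurryHom

end Uncurry

/-! ### Bijectivity on objects -/

section Comparison

variable {M : Type u} [SmallCategory M] [MonoidalCategory M]

namespace Enrichment

theorem toMetamodel_injective :
    Function.Injective (toMetamodel : Enrichment.{u} (DayPresheaf M) → Metamodel M) := by
  rintro ⟨C, H, j, m, h₁, h₂, h₃, h₄, h₅, h₆⟩ ⟨C', H', j', m', h₁', h₂', h₃', h₄', h₅', h₆'⟩ h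
  -- The category and `H` are identified before `j` and `m` are compared; only then do the latter
  -- have the same types, so that heterogeneous equalities become ordinary ones.
  obtain ⟨rfl, hc, hH, hj, hm⟩ := Metamodel.mk.inj h
  cases hc
  cases uncurryHom_injective (eq_of_heq hH)
  have ej : j = j' := funext fun A => dayUnit_hom_ext (congrFun (eq_of_heq hj) A)
  have em : m = m' := by
    funext A B D
    apply dayTensor_hom_ext
    intro Y X q p
    have h := congrFun (congrFun (congrFun (congrFun (congrFun (eq_of_heq hm) X) Y) A) B) D
    exact congrFun (congrFun h q) p
  subst ej em
  rfl

theorem toMetamodel_surjective :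
    Function.Surjective (toMetamodel : Enrichment.{u} (DayPresheaf M) → Metamodel M) := by
  rintro ⟨C, Φ, φ₀, φ, h₁, h₂, h₃, h₄, h₅, h₆⟩
  -- With `Φ` replaced by an uncurried functor, its values are literally values of hom presheaves,
  -- and no transport along an equality of functors is needed later.
  obtain ⟨H, rfl⟩ : ∃ H : Cᵒᵖ × C ⥤ DayPresheaf M, uncurryHom H = Φ := ⟨_, uncurryHom_curryHom Φ⟩
  -- Naturality of `φ` at identities of `C` is exactly what the coend requires to produce `m`.
  have nat {A B D : C} {Y Y' X X' : M} (y : Y' ⟶ Y) (x : X' ⟶ X)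
      (q : (homAt H B D).functor.obj (op Y)) (p : (homAt H A B).functor.obj (op X)) :
      φ ((homAt H B D).functor.map y.op q) ((homAt H A B).functor.map x.op p) =
        (homAt H A D).functor.map (y ⊗ₘ x).op (φ q p) := by
    exact (congrArg₂ φ (phiMap_uncurryHom_id_id H y q) (phiMap_uncurryHom_id_id H x p)).symm.trans
      ((h₂ x y (𝟙 A) (𝟙 D) q p).trans (phiMap_uncurryHom_id_id _ _ _))
  let m (A B D : C) : homAt H B D ⊗ homAt H A B ⟶ homAt H A D := dayDesc (fun q p => φ q p) nat
  have hm {A B D : C} {Y X : M} (q : (homAt H B D).functor.obj (op Y))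
      (p : (homAt H A B).functor.obj (op X)) :
      (m A B D).natTrans.app _ (dayIn _ _ q p) = φ q p := dayDesc_dayIn _ nat q p
  have hj (A : C) : (dayUnitDesc (F := homAt H A A) (φ₀ A)).natTrans.app _ (dayUnitElt M) = φ₀ A :=
    dayUnitDesc_dayUnitElt _
  refine ⟨{
    C := C
    H := H
    j := fun A => dayUnitDesc (φ₀ A)
    M := m
    j_natural := fun {A B} f => ?_
    M_natural := fun {A A' D D'} B a d => ?_
    M_extranatural := fun {B B'} A D b => ?_
    left_unit := fun A B => ?_
    right_unit := fun A B => ?_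
    assoc := fun A B C' D => ?_ }, ?_⟩
  · apply dayUnit_hom_ext
    have h := (phiMap_uncurryHom_id _ _ _ _).symm.trans
      ((h₁ f).trans (phiMap_uncurryHom_id _ _ _ _))
    refine (congrArg ((homMap H (𝟙 A) f).natTrans.app _) (hj A)).trans (h.trans ?_)
    exact (congrArg ((homMap H f (𝟙 B)).natTrans.app _) (hj B)).symm
  · apply dayTensor_hom_ext
    intro Y X q p
    have h := h₂ (𝟙 X) (𝟙 Y) a d q p
    -- Taking identities in `M` makes the restriction trivial, leaving naturality in `C` alone.
    rw [id_tensorHom_id] at h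
    replace h := (congrArg₂ φ (phiMap_uncurryHom_id H (𝟙 B) d q)
      (phiMap_uncurryHom_id H a (𝟙 B) p)).symm.trans (h.trans (phiMap_uncurryHom_id _ _ _ _))
    refine (congrArg ((m A' B D').natTrans.app _) (dayIn_tensorHom _ _ q p)).trans ?_
    refine (hm _ _).trans (h.trans ?_)
    exact (congrArg ((homMap H a d).natTrans.app _) (hm q p)).symm
  · apply dayTensor_hom_ext
    intro Y X q p
    have h := (congrArg (fun t => φ t p) (phiMap_uncurryHom_id H b (𝟙 D) q)).symm.trans
      ((h₃ b q p).trans (congrArg (φ q) (phiMap_uncurryHom_id H (𝟙 A) b p)))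
    refine (congrArg ((m A B D).natTrans.app _) (dayIn_whiskerRight _ _ q p)).trans ?_
    refine (hm _ _).trans (h.trans ?_)
    refine (hm _ _).symm.trans ?_
    exact (congrArg ((m A B' D).natTrans.app _) (dayIn_whiskerLeft _ _ q p)).symm
  · apply dayUnitTensor_hom_ext
    intro X p
    have h := (h₄ p).trans (phiMap_uncurryHom_id_id _ _ _)
    refine (congrArg ((m A B B).natTrans.app _) (dayIn_whiskerRight _ _ _ p)).trans ?_
    refine (hm _ _).trans (Eq.trans ?_ (h.trans (dayIn_leftUnitor _ p).symm))
    rw [hj]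
  · apply dayTensorUnit_hom_ext
    intro X p
    have h := (h₅ p).trans (phiMap_uncurryHom_id_id _ _ _)
    refine (congrArg ((m A A B).natTrans.app _) (dayIn_whiskerLeft _ _ p _)).trans ?_
    refine (hm _ _).trans (Eq.trans ?_ (h.trans (dayIn_rightUnitor _ p).symm))
    rw [hj]
  · apply dayTensorTensor_hom_ext
    intro Z Y X r q p
    have h := (phiMap_uncurryHom_id_id _ _ _).symm.trans (h₆ r q p)
    -- The metamodel axiom uses the inverse associator of `M`, while `dayIn_associator` restricts
    -- along the associator itself; inverting moves it to the other side.
    have h' : φ (φ r q) p = (homAt H A D).functor.map (α_ Z Y X).hom.op (φ r (φ q p)) :=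
      (functor_map_hom_map_inv _ _ _).symm.trans (congrArg _ h)
    refine (congrArg ((m A B D).natTrans.app _) (dayIn_whiskerRight _ _ _ p)).trans ?_
    refine (hm _ _).trans ?_
    rw [hm, h']
    refine Eq.symm ?_
    refine (congrArg (fun s => (m A C' D).natTrans.app _
      ((homAt H C' D ◁ m A B C').natTrans.app _ s)) (dayIn_associator _ _ _ r q p)).trans ?_
    rw [natTrans_naturality, natTrans_naturality, dayIn_whiskerLeft, hm, hm]
  -- The category and `Φ` are unchanged; `φ₀` and `φ` are recovered by evaluating the constructed
  -- morphisms on generators.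
  · refine (Metamodel.mk.injEq ..).mpr
      ⟨rfl, HEq.rfl, HEq.rfl, heq_of_eq (funext hj), heq_of_eq ?_⟩
    funext X Y A B D q p
    exact hm q p

/-! ### Bijectivity on 1-cells and 2-cells -/

variable {E E' : Enrichment.{u} (DayPresheaf M)}

theorem Hom.toMetamodel_injective :
    Function.Injective (Hom.toMetamodel : Hom E E' → _) := by
  rintro ⟨G, g, _, _, _⟩ ⟨G', g', _, _, _⟩ h
  obtain ⟨rfl, h⟩ := Metamodel.Hom.mk.inj h
  have eg : g = g' := by
    funext A B
    apply dayPresheaf_hom_ext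
    intro X p
    exact congrFun (congrFun (congrFun (congrFun (eq_of_heq h) X) A) B) p
  subst eg
  rfl

theorem Hom.toMetamodel_surjective :
    Function.Surjective (Hom.toMetamodel : Hom E E' → _) := by
  intro F
  let g (A B : E.C) : homAt E.H A B ⟶ homAt E'.H (F.G.obj A) (F.G.obj B) :=
    ⟨{ app := fun X => ↾ F.g X.unop A B
       naturality := fun X X' x => by
        ext p
        refine Eq.trans ?_ ((F.g_natural x.unop (𝟙 A) (𝟙 B) p).trans ?_)
        · exact congrArg (F.g X'.unop A B) (phiMap_uncurryHom_id_id E.H x.unop p).symm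
        · refine Eq.trans ?_ (phiMap_uncurryHom_id_id E'.H x.unop (F.g X.unop A B p))
          -- Fixing `A` and `B` leaves `F.G.map` of identities in the naturality equation of `F`;
          -- these must be removed to obtain plain restriction in the target presheaf.
          exact congrArg₂ (fun a b => phiMap (uncurryHom E'.H) x.unop a b (F.g X.unop A B p))
            (F.G.map_id A) (F.G.map_id B) }⟩
  refine ⟨{
    G := F.G
    g := g
    g_natural := fun {A A' B B'} a b => ?_
    unit := fun A => ?_
    comp := fun A B D => ?_ }, rfl⟩
  · apply dayPresheaf_hom_ext
    intro X p
    have h := F.g_natural (𝟙 X) a b p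
    refine Eq.trans ?_ (h.trans ?_)
    · exact congrArg (F.g X A' B') (functor_map_id_apply _ _).symm
    · exact functor_map_id_apply _ _
  · exact dayUnit_hom_ext (F.unit A)
  · apply dayTensor_hom_ext
    intro Y X q p
    refine (F.comp q p).trans ?_
    exact (congrArg ((E'.M _ _ _).natTrans.app _)
      (dayIn_tensorHom (g B D) (g A B) q p)).symm

/-- The transformation `θ` is the same on both sides. The two compatibility conditions differ only
by evaluation at elements and a restriction along `𝟙 X`, which acts trivially. -/
theorem Hom₂.toMetamodel_bijective {F F' : Hom E E'} :
    Function.Bijective (Hom₂.toMetamodel : Hom₂ F F' → _) := by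
  refine ⟨fun α β h => Hom₂.ext (congrArg Metamodel.Hom₂.θ h), fun β => ⟨⟨β.θ, fun A B => ?_⟩, rfl⟩⟩
  apply dayPresheaf_hom_ext
  intro X p
  exact (functor_map_id_apply _ _).symm.trans ((β.comm p).trans (functor_map_id_apply _ _))

end Enrichment

end Comparison

theorem mainTheorem8 (M : Type u) [SmallCategory M] [MonoidalCategory M] :
    (enrichToMtMod M).IsIsomorphism where
  bijective_obj := ⟨Enrichment.toMetamodel_injective, Enrichment.toMetamodel_surjective⟩
  bijective_map _ _ := ⟨Enrichment.Hom.toMetamodel_injective, Enrichment.Hom.toMetamodel_surjective⟩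
  bijective_map₂ _ _ := Enrichment.Hom₂.toMetamodel_bijective
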